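/- **Setting.** Let $f=\frac1n\sum_{i=1}^n f_i$ on $\mathbb{R}^d$, where each $f_i$ is differentiable with $L$-Lipschitz gradient, $f$ is bounded below, and $f$ is $\sigma$-bounded nonconvex ($\sigma>0$): $f$ is continuously differentiable and $f(y)-f(x)\ge\langle\nabla f(x),y-x\rangle-\frac{\sigma}{2}\|y-x\|^2$ for all $x,y$. Let $x_0$ satisfy $f(x_0)-\inf f\le\Delta$. Complexity is the number of incremental first-order oracle (IFO) calls, i.e. evaluations of a single component gradient. **BB-SARAH.** For $g=\frac1n\sum_i g_i$, BB-SARAH$(g,x_0,\eta^{(1)},m,K)$ with parameter $\lambda$ starts from $\tilde x^0=x_0$ and runs outer loops $j=1,\dots,K$. Loop $j$ uses the step size $\eta^{(j)}$, which is the given $\eta^{(1)}$ for $j=1$ and, for $j>1$, $$\eta^{(j)}=\frac1\lambda\,\frac{\|\tilde x^{j-1}-\tilde x^{j-2}\|^2}{\langle\tilde x^{j-1}-\tilde x^{j-2},\,\nabla g(\tilde x^{j-1})-\nabla g(\tilde x^{j-2})\rangle},$$ with $\eta^{(j)}=\eta^{(j-1)}$ if $\tilde x^{j-1}=\tilde x^{j-2}$.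 It sets $x_0^j=\tilde x^{j-1}$, $v_0=\nabla g(x_0^j)$ ($n$ IFO calls), $x_1^j=x_0^j-\eta^{(j)}v_0$. For $k=1,\dots,m-1$ it draws $i_k$ uniformly from $\{1,\dots,n\}$ and sets $v_k=\nabla g_{i_k}(x_k^j)-\nabla g_{i_k}(x_{k-1}^j)+v_{k-1}$ (two IFO calls) and $x_{k+1}^j=x_k^j-\eta^{(j)}v_k$. Finally $\tilde x^j$ is selected at random from $x_0^j,\dots,x_m^j$ according to a probability vector $p$. The output is $\tilde x^K$. **Scheme.** Fix $\theta>0$ and let $\tilde x_0=x_0$. For $s=1,\dots,S$ let $\tilde f_s(x)=f(x)+\frac{\sigma+\theta}{2}\|x-\tilde x_{s-1}\|^2$, with components $f_i(x)+\frac{\sigma+\theta}{2}\|x-\tilde x_{s-1}\|^2$, and let $\tilde x_s$ be the output of BB-SARAH$(\tilde f_s,\tilde x_{s-1},\eta_s,m_s,K_s)$ with selection probabilities $p_s$. The scheme returns $x_k:=\tilde x_k$ with $k$ uniform in $\{1,\dots,S\}$. **Claim.** There is an absolute constant $c>0$ such that for all $L,\sigma,\theta>0$, $\Delta\ge0$ and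 $B\ge1$ there is a constant $C>0$, depending only on these five numbers, such that the following two statements hold for all $n\ge1$, $d$, $f$, $x_0$ as above, every $\rho\in(0,1)$ and every sequence $\rho_s\le\rho$ ($s\ge1$). 1. Let $\varepsilon>0$. For every choice of the parameters (step-size parameter $\lambda$ and $\eta_s,m_s,K_s,p_s$) for which $$\mathbb{E}\|\nabla\tilde f_s(\tilde x_s)\|^2\le\rho_s\,\mathbb{E}\|\nabla\tilde f_s(\tilde x_{s-1})\|^2\qquad(1\le s\le S),\qquad(*)$$ the output satisfies $\mathbb{E}\|\nabla f(x_k)\|^2\le\varepsilon$ as soon as $S\ge\frac{C}{(1-\rho)\varepsilon}$ (with $S\ge1$). 2. If moreover $\rho_s\ge\rho^B$ for all $s$, then for every $\varepsilon\in(0,1]$ one can choose $S\ge1$ and $\eta_s>0$, $m_s\ge1$, $K_s\ge1$, $p_s$ for $1\le s\le S$ such that, with $\lambda=c\kappa^2$ and $\kappa=\frac{L+\sigma+\theta}{\theta}$ (the condition number of the surrogates), $(*)$ holds, $\mathbb{E}\|\nabla f(x_k)\|^2\le\varepsilon$, and the total number of IFO calls is, with certainty, at most $$C\,\frac{n}{(1-\rho)\,\varepsilon}\,\ln\frac1\rho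 .$$ -/

import Mathlib

noncomputable section

namespace RegSarah

/-- The Euclidean space `ℝ^d`. -/
abbrev Vec (d : ℕ) : Type := EuclideanSpace ℝ (Fin d)

variable {n d : ℕ}

/-! ### The objective functions -/

/-- The finite sum (empirical risk) `(1/n) ∑ i, g i x`. -/
def finiteSum (g : Fin n → Vec d → ℝ) (x : Vec d) : ℝ :=
  (1 / (n : ℝ)) * ∑ i, g i x

/-- `g` is differentiable and its gradient is `L`-Lipschitz. -/
def HasLipschitzGradient (L : ℝ) (g : Vec d → ℝ) : Prop :=
  Differentiable ℝ g ∧ ∀ x y : Vec d, ‖gradient g x - gradient g y‖ ≤ L * ‖x - y‖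

/-- `σ`-bounded nonconvexity (also called `σ`-weak convexity). -/
def BoundedNonconvex (σ : ℝ) (g : Vec d → ℝ) : Prop :=
  0 < σ ∧ ContDiff ℝ 1 g ∧
    ∀ x y : Vec d, g y - g x ≥ inner ℝ (gradient g x) (y - x) - σ / 2 * ‖y - x‖ ^ 2

/-- The components `f i x + (σ/2 + θ/2) ‖x - c‖²` of the regularized surrogate centred at `c`. -/
def surrogate (σ θ : ℝ) (c : Vec d) (f : Fin n → Vec d → ℝ) (i : Fin n) (x : Vec d) : ℝ :=
  f i x + (σ / 2 + θ / 2) * ‖x - c‖ ^ 2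

/-- The finite sum of the surrogate components is `f x + (σ/2 + θ/2) ‖x - c‖²`. -/
theorem finiteSum_surrogate [NeZero n] (σ θ : ℝ) (c : Vec d) (f : Fin n → Vec d → ℝ) (x : Vec d) :
    finiteSum (surrogate σ θ c f) x = finiteSum f x + (σ / 2 + θ / 2) * ‖x - c‖ ^ 2 := by
  have hn : (n : ℝ) ≠ 0 := Nat.cast_ne_zero.mpr (NeZero.ne n)
  simp only [finiteSum, surrogate, Finset.sum_add_distrib, Finset.sum_const, Finset.card_univ,
    Fintype.card_fin, nsmul_eq_mul]
  field_simp

/-! ### Expectations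

All the laws below have finite support (finitely many draws from finite sets), so that the series
that defines the expectation is always a finite sum. -/

/-- The expectation of `h` under the discrete law `q`. -/
def expect {α : Type*} (q : PMF α) (h : α → ℝ) : ℝ :=
  ∑' a, (q a).toReal * h a

/-! ### SARAH with Barzilai-Borwein step sizes, with a counter of oracle calls

An incremental first-order oracle (IFO) call evaluates one component gradient `gradient (g i) x`;
the fields `calls` count these calls. -/

/-- The full gradient, assembled from `n` IFO calls. -/
def fullGrad (g : Fin n → Vec d → ℝ) (x : Vec d) : Vec d :=
  (1 / (n : ℝ)) • ∑ i, gradient (g i) x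

/-- State of an inner loop: the iterates `x_0, x_1, …` computed so far, the current gradient
estimate `v`, and the number of IFO calls so far. -/
structure InnerState (d : ℕ) where
  iter : ℕ → Vec d
  dir : Vec d
  calls : ℕ

/-- Inner iteration `k ≥ 1`: draw `i` uniformly, set
`v_k = ∇g_i(x_k) - ∇g_i(x_{k-1}) + v_{k-1}` (two IFO calls) and `x_{k+1} = x_k - η v_k`. -/
def innerStep [NeZero n] (g : Fin n → Vec d → ℝ) (η : ℝ) (k : ℕ) (st : InnerState d) :
    PMF (InnerState d) :=
  (PMF.uniformOfFintype (Fin n)).map fun i =>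
    let v := gradient (g i) (st.iter k) - gradient (g i) (st.iter (k - 1)) + st.dir
    { iter := Function.update st.iter (k + 1) (st.iter k - η • v)
      dir := v
      calls := st.calls + 2 }

/-- The inner iterations `k = 1, …, j`. -/
def innerLoop [NeZero n] (g : Fin n → Vec d → ℝ) (η : ℝ) :
    ℕ → InnerState d → PMF (InnerState d)
  | 0, st => PMF.pure st
  | j + 1, st => (innerLoop g η j st).bind (innerStep g η (j + 1))

/-- State between outer loops: the current and the previous snapshot, the stored full gradient at
the previous snapshot, the last step size, and the number of IFO calls so far. -/
structure OuterState (d : ℕ) where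
  pt : Vec d
  prevPt : Vec d
  prevGrad : Vec d
  step : ℝ
  calls : ℕ

open Classical in
/-- The Barzilai-Borwein step size with parameter `lam`, where `v` is the full gradient at the
current snapshot. If the two snapshots coincide, the quotient is undefined and the last step size
is kept; this includes the first outer loop, which uses the given initial step size. -/
def bbStep (lam : ℝ) (st : OuterState d) (v : Vec d) : ℝ :=
  if st.pt = st.prevPt then st.step
  else (1 / lam) *
    (‖st.pt - st.prevPt‖ ^ 2 / inner ℝ (st.pt - st.prevPt) (v - st.prevGrad))

/-- One outer loop: full gradient `v_0` at the snapshot `x_0` (`n` IFO calls), choice of the step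
size, `x_1 = x_0 - η v_0`, inner iterations `k = 1, …, m - 1`, and selection of the new snapshot
from `x_0, …, x_m` according to `p`. -/
def outerStep [NeZero n] (g : Fin n → Vec d → ℝ) (lam : ℝ) (m : ℕ) (p : PMF (Fin (m + 1)))
    (st : OuterState d) : PMF (OuterState d) :=
  let v₀ := fullGrad g st.pt
  let η := bbStep lam st v₀
  (innerLoop g η (m - 1)
    { iter := Function.update (fun _ => st.pt) 1 (st.pt - η • v₀)
      dir := v₀
      calls := st.calls + n }).bind fun inn =>
    p.map fun r =>
      { pt := inn.iter r
        prevPt := st.pt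
        prevGrad := v₀
        step := η
        calls := inn.calls }

/-- `j` consecutive outer loops. -/
def outerLoop [NeZero n] (g : Fin n → Vec d → ℝ) (lam : ℝ) (m : ℕ) (p : PMF (Fin (m + 1))) :
    ℕ → OuterState d → PMF (OuterState d)
  | 0, st => PMF.pure st
  | j + 1, st => (outerLoop g lam m p j st).bind (outerStep g lam m p)

/-- `BB-SARAH(g, x₀, η₁, m, K)` with Barzilai-Borwein parameter `lam` and selection probabilities
`p`: the joint law of the returned point and of the number of IFO calls. -/
def bbSarah [NeZero n] (g : Fin n → Vec d → ℝ) (x₀ : Vec d) (η₁ lam : ℝ) (m K : ℕ)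
    (p : PMF (Fin (m + 1))) : PMF (Vec d × ℕ) :=
  (outerLoop g lam m p K
    { pt := x₀, prevPt := x₀, prevGrad := 0, step := η₁, calls := 0 }).map
      fun st => (st.pt, st.calls)

/-! ### The recursively regularized scheme for nonconvex problems -/

/-- The parameters of the calls of BB-SARAH: for the `s`-th call, `s = 1, 2, …`, the initial step
size, the length of the inner loops, the number of outer loops, and the selection
probabilities. -/
structure Params where
  η : ℕ → ℝ
  m : ℕ → ℕ
  K : ℕ → ℕ
  p : (s : ℕ) → PMF (Fin (m s + 1))

/-- The points produced so far and the number of IFO calls so far. -/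
structure Trajectory (d : ℕ) where
  pt : ℕ → Vec d
  calls : ℕ

/-- The `s`-th call: BB-SARAH is applied to the surrogate centred at the previous point and is
started there. -/
def regStep [NeZero n] (f : Fin n → Vec d → ℝ) (σ θ lam : ℝ) (P : Params) (s : ℕ)
    (tr : Trajectory d) : PMF (Trajectory d) :=
  (bbSarah (surrogate σ θ (tr.pt (s - 1)) f) (tr.pt (s - 1)) (P.η s) lam (P.m s) (P.K s)
    (P.p s)).map fun out =>
      { pt := Function.update tr.pt s out.1
        calls := tr.calls + out.2 }

/-- The law of the trajectory after the first `S` calls, started at `x₀`. -/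
def regRun [NeZero n] (f : Fin n → Vec d → ℝ) (σ θ lam : ℝ) (P : Params) (x₀ : Vec d) :
    ℕ → PMF (Trajectory d)
  | 0 => PMF.pure { pt := fun _ => x₀, calls := 0 }
  | s + 1 => (regRun f σ θ lam P x₀ s).bind (regStep f σ θ lam P (s + 1))

/-- The whole scheme with `S` calls: the joint law of the returned point `x̃_k`, with `k` uniform
in `{1, …, S}`, and of the total number of IFO calls. -/
def regOutput [NeZero n] (f : Fin n → Vec d → ℝ) (σ θ lam : ℝ) (P : Params) (x₀ : Vec d)
    (S : ℕ) (hS : 1 ≤ S) : PMF (Vec d × ℕ) :=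
  (regRun f σ θ lam P x₀ S).bind fun tr =>
    (PMF.uniformOfFinset (Finset.Icc 1 S) (Finset.nonempty_Icc.mpr hS)).map fun k =>
      (tr.pt k, tr.calls)

/-- The `s`-th call contracts the expected squared gradient norm of its surrogate by `r`:
`E ‖∇f̃_s(x̃_s)‖² ≤ r E ‖∇f̃_s(x̃_{s-1})‖²`, under the law `q` of the trajectory. -/
def Contracts (f : Fin n → Vec d → ℝ) (σ θ : ℝ) (q : PMF (Trajectory d)) (s : ℕ) (r : ℝ) :
    Prop :=
  expect q (fun tr =>
      ‖gradient (finiteSum (surrogate σ θ (tr.pt (s - 1)) f)) (tr.pt s)‖ ^ 2)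
    ≤ r * expect q (fun tr =>
      ‖gradient (finiteSum (surrogate σ θ (tr.pt (s - 1)) f)) (tr.pt (s - 1))‖ ^ 2)

end RegSarah

end

namespace RegSarah

/-! ### Calculus of expectations under laws with finite support -/

section Expectation

variable {α β : Type*}

/-! Outer level. Put `Φ = 2(σ+θ) f + ‖∇f‖²`. Weak convexity shows that `‖∇f(c)‖² - ‖∇f̃(x)‖² ≤ Φ(c)
- Φ(x)` for the surrogate `f̃` centred at `c` and every `x` (`potential_decrease`). Since `∇f̃(c) =
∇f(c)`, a contraction by `ρ` gives `(1-ρ) E‖∇f(x̃_{s-1})‖² ≤ E Φ(x̃_{s-1}) - E Φ(x̃_s)`. This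
telescopes: `f` is bounded below and `‖∇f(x₀)‖²` is `O(Δ)` (`norm_sq_gradient_le`), so the average
over `s` is `O(1/((1-ρ)S))` (`expect_regOutput_le`).

Inner level. The mean gradient of a surrogate is `θ`-strongly monotone and the component gradients
are `(L+σ+θ)`-Lipschitz; the components need not be convex. The Barzilai-Borwein quotient is
therefore confined to a fixed interval (`BBInvariant.bbStep_mem`), and `λ = 8κ²` makes the steps so
short that strong monotonicity of the mean dominates the second-order term. The recursive estimate
then decays geometrically while its accumulated error stays a small fraction of the initial squared
gradient (`expect_innerLoop_norm_sq_fullGrad_le`). An inner loop whose length depends only on `κ`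
halves the expected squared gradient norm.

Complexity. `K = O(B ln(1/ρ) + 1)` halvings reach `ρ^B`. As every call contracts at least by `1/2`,
`S = O(1/ε)` calls suffice whatever `ρ` is; the factor `1/(1-ρ)` only absorbs the rounding of `K`,
through `ln(1/ρ) ≥ 1-ρ`. -/

theorem expect_eq_sum (q : PMF α) {T : Finset α} (hT : q.support ⊆ T) (h : α → ℝ) :
    expect q h = ∑ a ∈ T, (q a).toReal * h a :=
  tsum_eq_sum fun a ha => by
    have h0 : q a = 0 := by
      by_contra h0
      exact ha (hT ((q.mem_support_iff a).2 h0))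
    simp [h0]

theorem sum_toReal_eq_one (q : PMF α) {T : Finset α} (hT : q.support ⊆ T) :
    ∑ a ∈ T, (q a).toReal = 1 := by
  have h : ∑' a, q a = ∑ a ∈ T, q a := tsum_eq_sum fun a ha => by
    by_contra h0
    exact ha (hT ((q.mem_support_iff a).2 h0))
  rw [← ENNReal.toReal_sum fun a _ => q.apply_ne_top a, ← h, q.tsum_coe, ENNReal.toReal_one]

theorem expect_congr {q : PMF α} {h₁ h₂ : α → ℝ} (h : ∀ a ∈ q.support, h₁ a = h₂ a) :
    expect q h₁ = expect q h₂ :=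
  tsum_congr fun a => by
    by_cases ha : q a = 0
    · simp [ha]
    · rw [h a ((q.mem_support_iff a).2 ha)]

theorem expect_const_mul (q : PMF α) (c : ℝ) (h : α → ℝ) :
    expect q (fun a => c * h a) = c * expect q h := by
  unfold expect
  rw [← tsum_mul_left]
  exact tsum_congr fun a => by ring

theorem expect_nonneg {q : PMF α} {h : α → ℝ} (h0 : ∀ a, 0 ≤ h a) : 0 ≤ expect q h :=
  tsum_nonneg fun a => mul_nonneg ENNReal.toReal_nonneg (h0 a)

theorem expect_pure (a : α) (h : α → ℝ) : expect (PMF.pure a) h = h a := by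
  rw [expect_eq_sum (T := {a}) _ (by simp)]
  simp

theorem expect_const {q : PMF α} (hq : q.support.Finite) (c : ℝ) :
    expect q (fun _ => c) = c := by
  have hT : q.support ⊆ hq.toFinset := by simp
  rw [expect_eq_sum q hT, ← Finset.sum_mul, sum_toReal_eq_one q hT, one_mul]

theorem expect_add {q : PMF α} (hq : q.support.Finite) (h₁ h₂ : α → ℝ) :
    expect q (fun a => h₁ a + h₂ a) = expect q h₁ + expect q h₂ := by
  have hT : q.support ⊆ hq.toFinset := by simp
  simp only [expect_eq_sum q hT, mul_add, Finset.sum_add_distrib]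

theorem expect_sum {ι : Type*} {q : PMF α} (hq : q.support.Finite) (s : Finset ι)
    (h : ι → α → ℝ) :
    expect q (fun a => ∑ i ∈ s, h i a) = ∑ i ∈ s, expect q (h i) := by
  have hT : q.support ⊆ hq.toFinset := by simp
  simp only [expect_eq_sum q hT, Finset.mul_sum]
  exact Finset.sum_comm

theorem expect_mono {q : PMF α} (hq : q.support.Finite) {h₁ h₂ : α → ℝ}
    (h : ∀ a ∈ q.support, h₁ a ≤ h₂ a) : expect q h₁ ≤ expect q h₂ := by
  have hT : q.support ⊆ hq.toFinset := by simp
  simp only [expect_eq_sum q hT]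
  exact Finset.sum_le_sum fun a ha =>
    mul_le_mul_of_nonneg_left (h a (by simpa using ha)) ENNReal.toReal_nonneg

theorem finite_support_pure (a : α) : (PMF.pure a).support.Finite := by simp

theorem finite_support_bind {q : PMF α} {k : α → PMF β} (hq : q.support.Finite)
    (hk : ∀ a, (k a).support.Finite) : (q.bind k).support.Finite := by
  rw [PMF.support_bind]
  exact hq.biUnion fun a _ => hk a

theorem finite_support_map {q : PMF α} (f : α → β) (hq : q.support.Finite) :
    (q.map f).support.Finite := by
  rw [PMF.support_map]
  exact hq.image f

/-- Finite supports turn both series into finite sums, which can be interchanged without any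
summability condition on `h`. -/
theorem expect_bind {q : PMF α} {k : α → PMF β} (hq : q.support.Finite)
    (hk : ∀ a, (k a).support.Finite) (h : β → ℝ) :
    expect (q.bind k) h = expect q fun a => expect (k a) h := by
  have hb := finite_support_bind hq hk
  have hA : q.support ⊆ hq.toFinset := by simp
  have hT : (q.bind k).support ⊆ hb.toFinset := by simp
  rw [expect_eq_sum _ hT, expect_eq_sum _ hA]
  have hval : ∀ b, ((q.bind k) b).toReal
      = ∑ a ∈ hq.toFinset, (q a).toReal * (k a b).toReal := fun b => by
    rw [PMF.bind_apply, tsum_eq_sum (s := hq.toFinset), ENNReal.toReal_sum]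
    · simp only [ENNReal.toReal_mul]
    · exact fun a _ => ENNReal.mul_ne_top (q.apply_ne_top a) ((k a).apply_ne_top b)
    · intro a ha
      have h0 : q a = 0 := by
        by_contra h0
        exact ha (by simpa using h0)
      simp [h0]
  simp only [hval, Finset.sum_mul]
  rw [Finset.sum_comm]
  refine Finset.sum_congr rfl fun a ha => ?_
  have hsub : (k a).support ⊆ hb.toFinset := fun b hbk => by
    rw [Set.Finite.coe_toFinset, PMF.mem_support_bind_iff]
    exact ⟨a, by simpa using ha, hbk⟩
  rw [expect_eq_sum _ hsub, Finset.mul_sum]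
  exact Finset.sum_congr rfl fun b _ => by ring

theorem expect_map {q : PMF α} (hq : q.support.Finite) (f : α → β) (h : β → ℝ) :
    expect (q.map f) h = expect q fun a => h (f a) := by
  rw [PMF.map, expect_bind (k := PMF.pure ∘ f) hq fun a => finite_support_pure (f a)]
  simp only [Function.comp_apply, expect_pure]

theorem expect_uniformOfFinset {s : Finset α} (hs : s.Nonempty) (h : α → ℝ) :
    expect (PMF.uniformOfFinset s hs) h = (1 / (s.card : ℝ)) * ∑ a ∈ s, h a := by
  rw [expect_eq_sum (T := s) _ (by simp), Finset.mul_sum]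
  refine Finset.sum_congr rfl fun a ha => ?_
  rw [PMF.uniformOfFinset_apply_of_mem hs ha]
  simp

theorem expect_uniformOfFintype {n : ℕ} [NeZero n] (h : Fin n → ℝ) :
    expect (PMF.uniformOfFintype (Fin n)) h = (1 / (n : ℝ)) * ∑ i, h i := by
  rw [PMF.uniformOfFintype, expect_uniformOfFinset]
  simp

/-- A quantity whose conditional expectation is multiplied by at most `b` is, in the mean,
multiplied by at most `b`. -/
theorem expect_bind_le {q : PMF α} {k : α → PMF β} (hq : q.support.Finite)
    (hk : ∀ a, (k a).support.Finite) {h : β → ℝ} {h' : α → ℝ} {b : ℝ}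
    (hb : ∀ a ∈ q.support, expect (k a) h ≤ b * h' a) :
    expect (q.bind k) h ≤ b * expect q h' := by
  rw [expect_bind hq hk, ← expect_const_mul]
  exact expect_mono hq hb

end Expectation

/-! ### Gradients of the objective and of its surrogates -/

section Gradients

variable {n d : ℕ}

/-- The gradients of the components are `L`-Lipschitz and their mean is `μ`-strongly monotone. -/
structure StronglyMonotoneSum (L μ : ℝ) (g : Fin n → Vec d → ℝ) : Prop where
  lipschitz : ∀ i x y, ‖gradient (g i) x - gradient (g i) y‖ ≤ L * ‖x - y‖
  monotone : ∀ x y, μ * ‖x - y‖ ^ 2 ≤ inner ℝ (x - y) (fullGrad g x - fullGrad g y)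

theorem gradient_finiteSum {g : Fin n → Vec d → ℝ} (hg : ∀ i, Differentiable ℝ (g i))
    (x : Vec d) : gradient (finiteSum g) x = fullGrad g x := by
  apply HasGradientAt.gradient
  have h := (HasFDerivAt.fun_sum (u := Finset.univ)
    fun i _ => (hg i x).hasGradientAt.hasFDerivAt).const_mul (1 / (n : ℝ))
  rw [hasGradientAt_iff_hasFDerivAt]
  have e : InnerProductSpace.toDual ℝ (Vec d) (fullGrad g x)
      = (1 / (n : ℝ)) • ∑ i, InnerProductSpace.toDual ℝ (Vec d) (gradient (g i) x) := by
    rw [fullGrad, map_smulₛₗ, map_sum, conj_trivial]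
  rw [e]
  exact h

theorem hasGradientAt_surrogate {σ θ : ℝ} {f : Fin n → Vec d → ℝ} (c : Vec d) {i : Fin n}
    (hf : Differentiable ℝ (f i)) (x : Vec d) :
    HasGradientAt (surrogate σ θ c f i) (gradient (f i) x + (σ + θ) • (x - c)) x := by
  have h1 := (hf x).hasGradientAt.hasFDerivAt
  have h2 : HasFDerivAt (fun y : Vec d => y - c) (ContinuousLinearMap.id ℝ (Vec d)) x :=
    (hasFDerivAt_id x).sub_const c
  have h3 := h1.add ((h2.norm_sq).const_mul (σ / 2 + θ / 2))
  rw [hasGradientAt_iff_hasFDerivAt]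
  refine (h3.congr_fderiv ?_ :)
  ext y
  simp
  ring

theorem differentiable_surrogate {σ θ : ℝ} {f : Fin n → Vec d → ℝ} (c : Vec d) {i : Fin n}
    (hf : Differentiable ℝ (f i)) : Differentiable ℝ (surrogate σ θ c f i) :=
  fun x => (hasGradientAt_surrogate c hf x).differentiableAt

theorem fullGrad_surrogate [NeZero n] {σ θ : ℝ} {f : Fin n → Vec d → ℝ} (c : Vec d)
    (hf : ∀ i, Differentiable ℝ (f i)) (x : Vec d) :
    fullGrad (surrogate σ θ c f) x = gradient (finiteSum f) x + (σ + θ) • (x - c) := by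
  have hn : (n : ℝ) ≠ 0 := Nat.cast_ne_zero.mpr (NeZero.ne n)
  rw [gradient_finiteSum hf]
  simp only [fullGrad, fun i => (hasGradientAt_surrogate (σ := σ) (θ := θ) c (hf i) x).gradient,
    Finset.sum_add_distrib, Finset.sum_const, Finset.card_univ, Fintype.card_fin, smul_add,
    ← Nat.cast_smul_eq_nsmul ℝ, smul_smul]
  congr 2
  field_simp

theorem gradient_finiteSum_surrogate [NeZero n] {σ θ : ℝ} {f : Fin n → Vec d → ℝ} (c : Vec d)
    (hf : ∀ i, Differentiable ℝ (f i)) (x : Vec d) :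
    gradient (finiteSum (surrogate σ θ c f)) x
      = gradient (finiteSum f) x + (σ + θ) • (x - c) := by
  rw [gradient_finiteSum fun i => differentiable_surrogate c (hf i), fullGrad_surrogate c hf]

theorem norm_mean_le [NeZero n] {a : Fin n → Vec d} {b : ℝ} (h : ∀ i, ‖a i‖ ≤ b) :
    ‖(1 / (n : ℝ)) • ∑ i, a i‖ ≤ b := by
  have hn : (0 : ℝ) < n := Nat.cast_pos.mpr (NeZero.pos n)
  rw [norm_smul, Real.norm_of_nonneg (by positivity)]
  calc 1 / (n : ℝ) * ‖∑ i, a i‖ ≤ 1 / (n : ℝ) * ∑ _i : Fin n, b := by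
        gcongr
        exact norm_sum_le_of_le _ fun i _ => h i
    _ = b := by
        simp only [Finset.sum_const, Finset.card_univ, Fintype.card_fin, nsmul_eq_mul]
        field_simp

theorem fullGrad_sub (g : Fin n → Vec d → ℝ) (x y : Vec d) :
    fullGrad g x - fullGrad g y
      = (1 / (n : ℝ)) • ∑ i, (gradient (g i) x - gradient (g i) y) := by
  simp only [fullGrad, Finset.sum_sub_distrib, smul_sub]

theorem norm_fullGrad_sub_le [NeZero n] {L : ℝ} {g : Fin n → Vec d → ℝ}
    (hg : ∀ i x y, ‖gradient (g i) x - gradient (g i) y‖ ≤ L * ‖x - y‖) (x y : Vec d) :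
    ‖fullGrad g x - fullGrad g y‖ ≤ L * ‖x - y‖ := by
  rw [fullGrad_sub]
  exact norm_mean_le fun i => hg i x y

/-- Adding the weak convexity inequality at `(x, y)` and at `(y, x)` bounds the monotonicity defect
of `∇f` by `σ`. The quadratic term contributes `σ + θ`, which leaves the modulus `θ`. -/
theorem stronglyMonotoneSum_surrogate [NeZero n] {L σ θ : ℝ} (hθ : 0 < θ)
    {f : Fin n → Vec d → ℝ} (hf : ∀ i, HasLipschitzGradient L (f i))
    (hσ : BoundedNonconvex σ (finiteSum f)) (c : Vec d) :
    StronglyMonotoneSum (L + σ + θ) θ (surrogate σ θ c f) where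
  lipschitz i x y := by
    have hσ0 := hσ.1
    simp only [(hasGradientAt_surrogate (σ := σ) (θ := θ) c (hf i).1 _).gradient]
    have e : gradient (f i) x + (σ + θ) • (x - c) - (gradient (f i) y + (σ + θ) • (y - c))
        = (gradient (f i) x - gradient (f i) y) + (σ + θ) • (x - y) := by module
    rw [e]
    refine (norm_add_le _ _).trans ?_
    rw [norm_smul, Real.norm_of_nonneg (by positivity)]
    linarith [(hf i).2 x y]
  monotone x y := by
    simp only [fullGrad_surrogate c fun i => (hf i).1]
    have e : gradient (finiteSum f) x + (σ + θ) • (x - c)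
          - (gradient (finiteSum f) y + (σ + θ) • (y - c))
        = (gradient (finiteSum f) x - gradient (finiteSum f) y) + (σ + θ) • (x - y) := by module
    rw [e, inner_add_right, inner_smul_right, real_inner_self_eq_norm_sq, inner_sub_right,
      real_inner_comm (gradient (finiteSum f) x) (x - y),
      real_inner_comm (gradient (finiteSum f) y) (x - y)]
    have h1 := hσ.2.2 x y
    have h2 := hσ.2.2 y x
    rw [← neg_sub x y, inner_neg_right, norm_neg] at h1
    linarith

/-- The squared gradient norm is controlled by the optimality gap. -/
theorem norm_sq_gradient_le [NeZero n] {L σ Δ : ℝ} (hL : 0 < L) {f : Fin n → Vec d → ℝ}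
    (hf : ∀ i, HasLipschitzGradient L (f i)) (hσ : BoundedNonconvex σ (finiteSum f))
    (hbdd : BddBelow (Set.range (finiteSum f))) {x₀ : Vec d}
    (hΔ : finiteSum f x₀ - (⨅ x, finiteSum f x) ≤ Δ) :
    ‖gradient (finiteSum f) x₀‖ ^ 2 ≤ 2 * (2 * L + σ) * Δ := by
  have hσ0 := hσ.1
  set w := gradient (finiteSum f) x₀ with hw
  -- This value maximizes the guaranteed decrease `t (1 - (L + σ/2) t) ‖w‖²` of a gradient step,
  -- which then equals `t ‖w‖² / 2`.
  set t : ℝ := 1 / (2 * L + σ) with ht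
  have ht0 : 0 < t := by positivity
  set y := x₀ - t • w with hy
  have hxy : x₀ - y = t • w := by rw [hy]; abel
  -- Weak convexity is used at the new point `y`. Replacing `∇f(y)` by `w` costs only a Lipschitz
  -- term, so no integration along the segment is needed.
  have h1 := hσ.2.2 y x₀
  have h2 : ‖gradient (finiteSum f) y - w‖ ≤ L * ‖y - x₀‖ := by
    rw [hw, gradient_finiteSum fun i => (hf i).1, gradient_finiteSum fun i => (hf i).1]
    exact norm_fullGrad_sub_le (fun i => (hf i).2) y x₀
  rw [norm_sub_rev y, hxy, norm_smul, Real.norm_of_nonneg ht0.le] at h2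
  rw [hxy, norm_smul, Real.norm_of_nonneg ht0.le, inner_smul_right] at h1
  have h3 : inner ℝ (gradient (finiteSum f) y) w
      = inner ℝ (gradient (finiteSum f) y - w) w + ‖w‖ ^ 2 := by
    rw [inner_sub_left, real_inner_self_eq_norm_sq]; ring
  have h4 : -(L * (t * ‖w‖) * ‖w‖) ≤ inner ℝ (gradient (finiteSum f) y - w) w := by
    have h5 := (abs_le.mp (abs_real_inner_le_norm (gradient (finiteSum f) y - w) w)).1
    have h6 := mul_le_mul_of_nonneg_right h2 (norm_nonneg w)
    linarith
  have h5 : (⨅ x, finiteSum f x) ≤ finiteSum f y := ciInf_le hbdd y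
  have h6 := mul_le_mul_of_nonneg_left h4 ht0.le
  have h7 : t * ‖w‖ ^ 2 - (L + σ / 2) * t * (t * ‖w‖ ^ 2) ≤ Δ := by
    rw [h3] at h1
    nlinarith
  have h8 : (L + σ / 2) * t = 1 / 2 := by rw [ht]; field_simp
  rw [h8] at h7
  have h9 : ‖w‖ ^ 2 = 2 * (2 * L + σ) * (t * ‖w‖ ^ 2 - 1 / 2 * (t * ‖w‖ ^ 2)) := by
    rw [ht]; field_simp; ring
  rw [h9]
  gcongr

/-- One inexact proximal step decreases the potential `2 (σ + θ) f + ‖∇f‖²` by at least the drop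
from the squared gradient norm at the centre to the squared residual. -/
theorem potential_decrease [NeZero n] {σ θ : ℝ} (hθ : 0 < θ) {f : Fin n → Vec d → ℝ}
    (hf : ∀ i, Differentiable ℝ (f i)) (hσ : BoundedNonconvex σ (finiteSum f)) (c x : Vec d) :
    ‖gradient (finiteSum f) c‖ ^ 2 - ‖gradient (finiteSum (surrogate σ θ c f)) x‖ ^ 2
      ≤ (2 * (σ + θ) * finiteSum f c + ‖gradient (finiteSum f) c‖ ^ 2)
        - (2 * (σ + θ) * finiteSum f x + ‖gradient (finiteSum f) x‖ ^ 2) := by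
  have hσ0 := hσ.1
  have h1 := hσ.2.2 x c
  rw [gradient_finiteSum_surrogate c hf, norm_add_sq_real, norm_smul, inner_smul_right,
    Real.norm_of_nonneg (by positivity)]
  rw [← neg_sub x c, inner_neg_right, norm_neg] at h1
  -- The square expands into `(σ+θ)² ‖x-c‖²` and a cross term; weak convexity, multiplied by
  -- `2(σ+θ)`, consumes `σ(σ+θ) ‖x-c‖²`. This is the surplus.
  have h2 : 0 ≤ (σ + θ) * θ * ‖x - c‖ ^ 2 := by positivity
  have h3 := mul_le_mul_of_nonneg_left h1 (by positivity : 0 ≤ 2 * (σ + θ))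
  nlinarith

end Gradients

/-! ### One inner loop: decay and error of the recursive gradient estimate -/

section InnerLoop

variable {n d : ℕ}

theorem mean_norm_add_sq [NeZero n] (v : Vec d) (a : Fin n → Vec d) :
    (1 / (n : ℝ)) * ∑ i, ‖v + a i‖ ^ 2
      = ‖v‖ ^ 2 + 2 * inner ℝ v ((1 / (n : ℝ)) • ∑ i, a i)
        + (1 / (n : ℝ)) * ∑ i, ‖a i‖ ^ 2 := by
  have hn : (n : ℝ) ≠ 0 := Nat.cast_ne_zero.mpr (NeZero.ne n)
  simp only [norm_add_sq_real, Finset.sum_add_distrib, Finset.sum_const, Finset.card_univ,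
    Fintype.card_fin, nsmul_eq_mul, inner_smul_right, inner_sum, ← Finset.mul_sum]
  field_simp

theorem mean_norm_sq_le [NeZero n] {a : Fin n → Vec d} {b : ℝ} (h : ∀ i, ‖a i‖ ≤ b) :
    (1 / (n : ℝ)) * ∑ i, ‖a i‖ ^ 2 ≤ b ^ 2 := by
  have hn : (0 : ℝ) < n := Nat.cast_pos.mpr (NeZero.pos n)
  calc (1 / (n : ℝ)) * ∑ i, ‖a i‖ ^ 2 ≤ 1 / (n : ℝ) * ∑ _i : Fin n, b ^ 2 := by
        gcongr with i
        exact h i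
    _ = b ^ 2 := by
        simp only [Finset.sum_const, Finset.card_univ, Fintype.card_fin, nsmul_eq_mul]
        field_simp

theorem StronglyMonotoneSum.inner_step_le {L μ η : ℝ} {g : Fin n → Vec d → ℝ}
    (hg : StronglyMonotoneSum L μ g) (hη : 0 < η) {x y v : Vec d} (hy : y = x - η • v) :
    inner ℝ v (fullGrad g y - fullGrad g x) ≤ -(η * μ * ‖v‖ ^ 2) := by
  have h := hg.monotone y x
  have e : y - x = -(η • v) := by rw [hy]; abel
  rw [e, norm_neg, inner_neg_left, norm_smul, Real.norm_of_nonneg hη.le, inner_smul_left] at h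
  simp only [conj_trivial] at h
  refine le_of_mul_le_mul_left ?_ hη
  linarith

theorem StronglyMonotoneSum.norm_gradient_step_le {L μ η : ℝ} {g : Fin n → Vec d → ℝ}
    (hg : StronglyMonotoneSum L μ g) (hη : 0 < η) {x y v : Vec d} (hy : y = x - η • v)
    (i : Fin n) : ‖gradient (g i) y - gradient (g i) x‖ ≤ L * (η * ‖v‖) := by
  have h := hg.lipschitz i y x
  have e : y - x = -(η • v) := by rw [hy]; abel
  rwa [e, norm_neg, norm_smul, Real.norm_of_nonneg hη.le] at h

/-- The recursive gradient estimate contracts in mean square under small step sizes. -/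
theorem StronglyMonotoneSum.mean_norm_sq_dir_le [NeZero n] {L μ η : ℝ}
    {g : Fin n → Vec d → ℝ} (hg : StronglyMonotoneSum L μ g) (hη : 0 < η)
    (hLη : η * L ^ 2 ≤ μ) {x y v : Vec d} (hy : y = x - η • v) :
    (1 / (n : ℝ)) * ∑ i, ‖v + (gradient (g i) y - gradient (g i) x)‖ ^ 2
      ≤ (1 - η * μ) * ‖v‖ ^ 2 := by
  rw [mean_norm_add_sq, ← fullGrad_sub]
  have h1 := hg.inner_step_le hη hy
  have h2 := mean_norm_sq_le fun i => hg.norm_gradient_step_le hη hy i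
  -- The cross term sees only the mean gradient and gives `-2ημ‖v‖²`; the quadratic term is at most
  -- `η²L²‖v‖²`, hence at most half of that gain.
  have h3 : η * L ^ 2 * (η * ‖v‖ ^ 2) ≤ μ * (η * ‖v‖ ^ 2) :=
    mul_le_mul_of_nonneg_right hLη (by positivity)
  nlinarith

/-- The variance of the recursive gradient estimate accumulates additively. -/
theorem StronglyMonotoneSum.mean_norm_sq_error_le [NeZero n] {L μ η : ℝ}
    {g : Fin n → Vec d → ℝ} (hg : StronglyMonotoneSum L μ g) (hη : 0 < η)
    {x y v : Vec d} (hy : y = x - η • v) :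
    (1 / (n : ℝ)) * ∑ i, ‖fullGrad g y - (gradient (g i) y - gradient (g i) x + v)‖ ^ 2
      ≤ ‖fullGrad g x - v‖ ^ 2 + (L * (η * ‖v‖)) ^ 2 := by
  have e : ∀ i, ‖fullGrad g y - (gradient (g i) y - gradient (g i) x + v)‖
      = ‖(v - fullGrad g y) + (gradient (g i) y - gradient (g i) x)‖ := fun i => by
    rw [← norm_neg]; congr 1; abel
  simp only [e]
  rw [mean_norm_add_sq, ← fullGrad_sub]
  have h2 := mean_norm_sq_le fun i => hg.norm_gradient_step_le hη hy i
  -- The sampled increment has mean `∇g(y) - ∇g(x)`, so the old error has the same cross term as the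
  -- new mean square. Only the variance of the increment is added.
  have h3 : ‖fullGrad g x - v‖ ^ 2 = ‖v - fullGrad g y‖ ^ 2
      + 2 * inner ℝ (v - fullGrad g y) (fullGrad g y - fullGrad g x)
      + ‖fullGrad g y - fullGrad g x‖ ^ 2 := by
    rw [← norm_add_sq_real, ← norm_neg]; congr 2; abel
  nlinarith [sq_nonneg ‖fullGrad g y - fullGrad g x‖]

variable [NeZero n]

theorem finite_support_innerStep (g : Fin n → Vec d → ℝ) (η : ℝ) (k : ℕ) (st : InnerState d) :
    (innerStep g η k st).support.Finite :=
  finite_support_map _ (Set.toFinite _)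

theorem finite_support_innerLoop (g : Fin n → Vec d → ℝ) (η : ℝ) (j : ℕ) (st : InnerState d) :
    (innerLoop g η j st).support.Finite := by
  induction j with
  | zero => exact finite_support_pure st
  | succ j ih => exact finite_support_bind ih fun a => finite_support_innerStep g η (j + 1) a

theorem expect_innerStep (g : Fin n → Vec d → ℝ) (η : ℝ) (k : ℕ) (st : InnerState d)
    (h : Vec d → Vec d → ℝ) :
    expect (innerStep g η k st) (fun st' => h (st'.iter k) st'.dir)
      = (1 / (n : ℝ)) * ∑ i, h (st.iter k)
          (gradient (g i) (st.iter k) - gradient (g i) (st.iter (k - 1)) + st.dir) := by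
  rw [innerStep, expect_map (Set.toFinite _), expect_uniformOfFintype]
  simp

theorem innerLoop_support {g : Fin n → Vec d → ℝ} {η : ℝ} {st₀ : InnerState d}
    (h₀ : st₀.iter 1 = st₀.iter 0 - η • st₀.dir) {j : ℕ} :
    ∀ st ∈ (innerLoop g η j st₀).support,
      st.iter (j + 1) = st.iter j - η • st.dir ∧ st.calls = st₀.calls + 2 * j := by
  induction j with
  | zero =>
    intro st hst
    rw [innerLoop, PMF.support_pure, Set.mem_singleton_iff] at hst
    subst hst
    exact ⟨h₀, by simp⟩
  | succ j ih =>
    intro st hst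
    rw [innerLoop, PMF.mem_support_bind_iff] at hst
    obtain ⟨s, hs, hst⟩ := hst
    rw [innerStep, PMF.support_map] at hst
    obtain ⟨i, -, rfl⟩ := hst
    refine ⟨by simp, ?_⟩
    simp only [(ih s hs).2]
    ring

theorem expect_innerLoop_dir_le {L μ η : ℝ} {g : Fin n → Vec d → ℝ}
    (hg : StronglyMonotoneSum L μ g) (hη : 0 < η) (hLη : η * L ^ 2 ≤ μ) (hημ : η * μ ≤ 1)
    {st₀ : InnerState d} (h₀ : st₀.iter 1 = st₀.iter 0 - η • st₀.dir) (j : ℕ) :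
    expect (innerLoop g η j st₀) (fun st => ‖st.dir‖ ^ 2)
      ≤ (1 - η * μ) ^ j * ‖st₀.dir‖ ^ 2 := by
  induction j with
  | zero => simp [innerLoop, expect_pure]
  | succ j ih =>
    have h : expect (innerLoop g η (j + 1) st₀) (fun st => ‖st.dir‖ ^ 2)
        ≤ (1 - η * μ) * expect (innerLoop g η j st₀) (fun st => ‖st.dir‖ ^ 2) := by
      refine expect_bind_le (finite_support_innerLoop g η j st₀)
        (finite_support_innerStep g η (j + 1)) fun st hst => ?_
      rw [expect_innerStep g η (j + 1) st fun _ v => ‖v‖ ^ 2]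
      simp only [add_comm _ st.dir]
      exact hg.mean_norm_sq_dir_le hη hLη (innerLoop_support h₀ st hst).1
    calc _ ≤ _ := h
      _ ≤ (1 - η * μ) * ((1 - η * μ) ^ j * ‖st₀.dir‖ ^ 2) :=
        mul_le_mul_of_nonneg_left ih (by linarith)
      _ = _ := by ring

/-- The weight `ηL²/μ` is chosen so that the error increment `(Lη‖v‖)²` equals the amount `(ηL²/μ)
ημ‖v‖²` lost by the weighted direction term. The sum is then a supermartingale. -/
theorem expect_innerLoop_error_le {L μ η : ℝ} {g : Fin n → Vec d → ℝ}
    (hg : StronglyMonotoneSum L μ g) (hμ : 0 < μ) (hη : 0 < η) (hLη : η * L ^ 2 ≤ μ)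
    {st₀ : InnerState d} (h₀ : st₀.iter 1 = st₀.iter 0 - η • st₀.dir) (j : ℕ) :
    expect (innerLoop g η j st₀)
        (fun st => ‖fullGrad g (st.iter j) - st.dir‖ ^ 2 + η * L ^ 2 / μ * ‖st.dir‖ ^ 2)
      ≤ ‖fullGrad g (st₀.iter 0) - st₀.dir‖ ^ 2 + η * L ^ 2 / μ * ‖st₀.dir‖ ^ 2 := by
  induction j with
  | zero => simp [innerLoop, expect_pure]
  | succ j ih =>
    refine le_trans ?_ ih
    rw [innerLoop, ← one_mul (expect (innerLoop g η j st₀) _)]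
    refine expect_bind_le (finite_support_innerLoop g η j st₀)
      (finite_support_innerStep g η (j + 1)) fun st hst => ?_
    have hst := (innerLoop_support h₀ st hst).1
    rw [expect_innerStep g η (j + 1) st
      fun x v => ‖fullGrad g x - v‖ ^ 2 + η * L ^ 2 / μ * ‖v‖ ^ 2,
      Finset.sum_add_distrib, mul_add, ← Finset.mul_sum, mul_left_comm, one_mul,
      Nat.add_sub_cancel]
    have h1 := hg.mean_norm_sq_error_le hη hst
    have h2 := hg.mean_norm_sq_dir_le hη hLη hst
    simp only [add_comm st.dir] at h2
    have h3 := mul_le_mul_of_nonneg_left h2 (by positivity : 0 ≤ η * L ^ 2 / μ)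
    have h4 : (L * (η * ‖st.dir‖)) ^ 2 + η * L ^ 2 / μ * ((1 - η * μ) * ‖st.dir‖ ^ 2)
        = η * L ^ 2 / μ * ‖st.dir‖ ^ 2 := by
      field_simp; ring
    linarith

/-- The squared gradient norm after the last step of an inner loop. -/
theorem StronglyMonotoneSum.norm_sq_fullGrad_step_le {L μ η : ℝ} {g : Fin n → Vec d → ℝ}
    (hg : StronglyMonotoneSum L μ g) (hμ : 0 < μ) (hη : 0 < η) (hLη : η * L ^ 2 ≤ μ)
    {x y v : Vec d} (hy : y = x - η • v) :
    ‖fullGrad g y‖ ^ 2 ≤ 2 * ‖fullGrad g x - v‖ ^ 2 + 2 * ‖v‖ ^ 2 := by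
  set δ := fullGrad g y - fullGrad g x with hδ
  have h1 := hg.inner_step_le hη hy
  have h2 : ‖δ‖ ≤ L * (η * ‖v‖) := by
    have h := norm_fullGrad_sub_le hg.lipschitz y x
    have e : y - x = -(η • v) := by rw [hy]; abel
    rwa [e, norm_neg, norm_smul, Real.norm_of_nonneg hη.le] at h
  have h3 : ‖δ‖ ^ 2 ≤ (L * (η * ‖v‖)) ^ 2 := by gcongr
  have h4 : η * L ^ 2 * (η * ‖v‖ ^ 2) ≤ μ * (η * ‖v‖ ^ 2) :=
    mul_le_mul_of_nonneg_right hLη (by positivity)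
  have h5 : ‖v + δ‖ ^ 2 ≤ ‖v‖ ^ 2 := by
    rw [norm_add_sq_real]
    have : 0 ≤ μ * (η * ‖v‖ ^ 2) := by positivity
    nlinarith
  -- No estimate is computed at the last iterate `y`. Its gradient is the old error plus `v + δ`,
  -- and the full-gradient increment `δ` does not lengthen `v`.
  have e : fullGrad g y = (fullGrad g x - v) + (v + δ) := by rw [hδ]; abel
  have h6 := norm_add_le (fullGrad g x - v) (v + δ)
  rw [← e] at h6
  have h7 : ‖fullGrad g y‖ ^ 2 ≤ (‖fullGrad g x - v‖ + ‖v + δ‖) ^ 2 := by gcongr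
  nlinarith [sq_nonneg (‖fullGrad g x - v‖ - ‖v + δ‖)]

theorem expect_innerLoop_norm_sq_fullGrad_le {L μ η : ℝ} {g : Fin n → Vec d → ℝ}
    (hg : StronglyMonotoneSum L μ g) (hμ : 0 < μ) (hη : 0 < η) (hLη : η * L ^ 2 ≤ μ)
    (hημ : η * μ ≤ 1) {st₀ : InnerState d} (h₀ : st₀.iter 1 = st₀.iter 0 - η • st₀.dir)
    (hdir : st₀.dir = fullGrad g (st₀.iter 0)) (j : ℕ) :
    expect (innerLoop g η j st₀) (fun st => ‖fullGrad g (st.iter (j + 1))‖ ^ 2)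
      ≤ 2 * (η * L ^ 2 / μ + (1 - η * μ) ^ j) * ‖st₀.dir‖ ^ 2 := by
  have hfin := finite_support_innerLoop g η j st₀
  have h1 := expect_innerLoop_error_le hg hμ hη hLη h₀ j
  rw [← hdir, sub_self, norm_zero] at h1
  have h2 := expect_innerLoop_dir_le hg hη hLη hημ h₀ j
  have h3 : expect (innerLoop g η j st₀) (fun st => ‖fullGrad g (st.iter (j + 1))‖ ^ 2)
      ≤ expect (innerLoop g η j st₀) (fun st =>
        2 * (‖fullGrad g (st.iter j) - st.dir‖ ^ 2 + η * L ^ 2 / μ * ‖st.dir‖ ^ 2)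
          + 2 * ‖st.dir‖ ^ 2) := by
    refine expect_mono hfin fun st hst => ?_
    have h := hg.norm_sq_fullGrad_step_le hμ hη hLη (innerLoop_support h₀ st hst).1
    have h' : 0 ≤ η * L ^ 2 / μ * ‖st.dir‖ ^ 2 := by positivity
    linarith
  rw [expect_add hfin, expect_const_mul, expect_const_mul] at h3
  linarith

end InnerLoop

/-! ### Outer loops: range of the step sizes and linear convergence -/

section OuterLoop

variable {n d : ℕ} [NeZero n]

/-- In `outerStep` the selected index is read in `ℕ`, so `p` enters through its pushforward along
`Fin.val`, in this monadic form. -/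
theorem finite_support_fin_val {m : ℕ} (p : PMF (Fin m)) :
    (do let a ← p; pure (a : ℕ) : PMF ℕ).support.Finite :=
  finite_support_map (fun a : Fin m => (a : ℕ)) (Set.toFinite p.support)

theorem expect_fin_val_pure {m : ℕ} (r : Fin m) (h : ℕ → ℝ) :
    expect (do let a ← PMF.pure r; pure (a : ℕ) : PMF ℕ) h = h r := by
  change expect ((PMF.pure r).map fun a : Fin m => (a : ℕ)) h = h r
  rw [PMF.pure_map, expect_pure]

theorem finite_support_outerStep (g : Fin n → Vec d → ℝ) (lam : ℝ) (m : ℕ)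
    (p : PMF (Fin (m + 1))) (st : OuterState d) : (outerStep g lam m p st).support.Finite :=
  finite_support_bind (finite_support_innerLoop _ _ _ _) fun _ =>
    finite_support_map _ (finite_support_fin_val p)

theorem finite_support_outerLoop (g : Fin n → Vec d → ℝ) (lam : ℝ) (m : ℕ)
    (p : PMF (Fin (m + 1))) (j : ℕ) (st : OuterState d) :
    (outerLoop g lam m p j st).support.Finite := by
  induction j with
  | zero => exact finite_support_pure st
  | succ j ih => exact finite_support_bind ih fun a => finite_support_outerStep g lam m p a

theorem finite_support_bbSarah (g : Fin n → Vec d → ℝ) (x₀ : Vec d) (η₁ lam : ℝ) (m K : ℕ)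
    (p : PMF (Fin (m + 1))) : (bbSarah g x₀ η₁ lam m K p).support.Finite :=
  finite_support_map _ (finite_support_outerLoop _ _ _ _ _ _)

theorem outerStep_support_calls {g : Fin n → Vec d → ℝ} {lam : ℝ} {m : ℕ}
    {p : PMF (Fin (m + 1))} {st : OuterState d} :
    ∀ st' ∈ (outerStep g lam m p st).support, st'.calls = st.calls + (n + 2 * (m - 1)) := by
  intro st' h
  rw [outerStep, PMF.mem_support_bind_iff] at h
  obtain ⟨inn, hinn, h⟩ := h
  rw [PMF.support_map] at h
  obtain ⟨r, -, rfl⟩ := h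
  rw [(innerLoop_support (by simp) inn hinn).2]
  ring

theorem bbSarah_support_calls {g : Fin n → Vec d → ℝ} {x₀ : Vec d} {η₁ lam : ℝ} {m K : ℕ}
    {p : PMF (Fin (m + 1))} :
    ∀ out ∈ (bbSarah g x₀ η₁ lam m K p).support, out.2 = K * (n + 2 * (m - 1)) := by
  intro out h
  rw [bbSarah, PMF.support_map] at h
  obtain ⟨st, hst, rfl⟩ := h
  simp only
  induction K generalizing st with
  | zero =>
    rw [outerLoop, PMF.support_pure, Set.mem_singleton_iff] at hst
    simp [hst]
  | succ K ih =>
    rw [outerLoop, PMF.mem_support_bind_iff] at hst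
    obtain ⟨s, hs, hst⟩ := hst
    rw [outerStep_support_calls st hst, ih s hs]
    ring

/-- The stored gradient belongs to the previous snapshot, and the last step size lies in the
range of the Barzilai-Borwein step sizes. -/
structure BBInvariant (L μ lam : ℝ) (g : Fin n → Vec d → ℝ) (st : OuterState d) : Prop where
  grad : st.pt ≠ st.prevPt → st.prevGrad = fullGrad g st.prevPt
  lower : 1 / (lam * L) ≤ st.step
  upper : st.step ≤ 1 / (lam * μ)

/-- Strong monotonicity bounds the inner product in the quotient from below, Cauchy-Schwarz and the
Lipschitz bound from above. When the snapshots coincide, the bounds are inherited from the last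
step. -/
theorem BBInvariant.bbStep_mem {L μ lam : ℝ} {g : Fin n → Vec d → ℝ} {st : OuterState d}
    (hst : BBInvariant L μ lam g st) (hg : StronglyMonotoneSum L μ g) (hμ : 0 < μ)
    (hlam : 0 < lam) :
    1 / (lam * L) ≤ bbStep lam st (fullGrad g st.pt) ∧
      bbStep lam st (fullGrad g st.pt) ≤ 1 / (lam * μ) := by
  unfold bbStep
  split_ifs with h
  · exact ⟨hst.lower, hst.upper⟩
  · rw [hst.grad h]
    have h0 : 0 < ‖st.pt - st.prevPt‖ := norm_pos_iff.mpr (sub_ne_zero.mpr h)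
    have h1 := hg.monotone st.pt st.prevPt
    have h2 := real_inner_le_norm (st.pt - st.prevPt)
      (fullGrad g st.pt - fullGrad g st.prevPt)
    have h3 := mul_le_mul_of_nonneg_left
      (norm_fullGrad_sub_le hg.lipschitz st.pt st.prevPt) h0.le
    set D := inner ℝ (st.pt - st.prevPt) (fullGrad g st.pt - fullGrad g st.prevPt)
    have hD : 0 < D := lt_of_lt_of_le (by positivity) h1
    have h4 : D ≤ L * ‖st.pt - st.prevPt‖ ^ 2 := by linarith
    have hL : 0 < L := by
      by_contra hL
      nlinarith [sq_nonneg ‖st.pt - st.prevPt‖]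
    rw [div_mul_div_comm, one_mul]
    constructor
    · rw [div_le_div_iff₀ (by positivity) (by positivity)]
      nlinarith
    · rw [div_le_div_iff₀ (by positivity) (by positivity)]
      nlinarith

theorem BBInvariant.outerStep {L μ lam : ℝ} {g : Fin n → Vec d → ℝ} {st : OuterState d}
    (hst : BBInvariant L μ lam g st) (hg : StronglyMonotoneSum L μ g) (hμ : 0 < μ)
    (hlam : 0 < lam) {m : ℕ} {p : PMF (Fin (m + 1))} :
    ∀ st' ∈ (outerStep g lam m p st).support, BBInvariant L μ lam g st' := by
  intro st' h
  rw [RegSarah.outerStep, PMF.mem_support_bind_iff] at h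
  obtain ⟨inn, -, h⟩ := h
  rw [PMF.support_map] at h
  obtain ⟨r, -, rfl⟩ := h
  have hs := hst.bbStep_mem hg hμ hlam
  exact ⟨fun _ => rfl, hs.1, hs.2⟩

theorem BBInvariant.outerLoop {L μ lam : ℝ} {g : Fin n → Vec d → ℝ} {st : OuterState d}
    (hst : BBInvariant L μ lam g st) (hg : StronglyMonotoneSum L μ g) (hμ : 0 < μ)
    (hlam : 0 < lam) {m : ℕ} {p : PMF (Fin (m + 1))} {j : ℕ} :
    ∀ st' ∈ (outerLoop g lam m p j st).support, BBInvariant L μ lam g st' := by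
  induction j with
  | zero =>
    intro st' h
    rw [RegSarah.outerLoop, PMF.support_pure, Set.mem_singleton_iff] at h
    rwa [h]
  | succ j ih =>
    intro st' h
    rw [RegSarah.outerLoop, PMF.mem_support_bind_iff] at h
    obtain ⟨s, hs, h⟩ := h
    exact (ih s hs).outerStep hg hμ hlam st' h

/-- With the last inner iterate as new snapshot, an outer loop halves the expected squared
gradient norm, as soon as the inner loop is long enough. -/
theorem BBInvariant.expect_outerStep_le {L μ : ℝ} {g : Fin n → Vec d → ℝ}
    {st : OuterState d} (hst : BBInvariant L μ (8 * (L / μ) ^ 2) g st)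
    (hg : StronglyMonotoneSum L μ g) (hμ : 0 < μ) (hμL : μ ≤ L) {N : ℕ}
    (hN : (1 - 1 / (8 * (L / μ) ^ 3)) ^ N ≤ 1 / 8) :
    expect (RegSarah.outerStep g (8 * (L / μ) ^ 2) (N + 1) (PMF.pure (Fin.last (N + 1))) st)
        (fun st' => ‖fullGrad g st'.pt‖ ^ 2)
      ≤ 1 / 2 * ‖fullGrad g st.pt‖ ^ 2 := by
  have hL : 0 < L := hμ.trans_le hμL
  obtain ⟨h1, h2⟩ := hst.bbStep_mem hg hμ (by positivity)
  rw [RegSarah.outerStep, expect_bind (finite_support_innerLoop _ _ _ _)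
    fun _ => finite_support_map _ (finite_support_fin_val _)]
  simp only [expect_map (finite_support_fin_val _), expect_fin_val_pure,
    Nat.add_sub_cancel, Fin.val_last]
  set η := bbStep (8 * (L / μ) ^ 2) st (fullGrad g st.pt)
  have hη : 0 < η := lt_of_lt_of_le (by positivity) h1
  -- The upper end of the step range is `μ / (8L²)`; it makes the error term at most `1/8`. The
  -- lower end gives `ημ ≥ 1/(8κ³)` with `κ = L/μ`, so `N` iterations bring the decay term to `1/8`.
  -- Together, `2 (1/8 + 1/8) = 1/2`.
  have hα : η * L ^ 2 / μ ≤ 1 / 8 := by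
    calc η * L ^ 2 / μ ≤ 1 / (8 * (L / μ) ^ 2 * μ) * L ^ 2 / μ := by gcongr
      _ = 1 / 8 := by field_simp
  have hLη : η * L ^ 2 ≤ μ := by
    rw [div_le_iff₀ hμ] at hα
    linarith
  have hημ : 1 / (8 * (L / μ) ^ 3) ≤ η * μ := by
    calc 1 / (8 * (L / μ) ^ 3) = 1 / (8 * (L / μ) ^ 2 * L) * μ := by field_simp
      _ ≤ η * μ := by gcongr
  have hημ1 : η * μ ≤ 1 := by
    have h3 : μ ^ 2 ≤ L ^ 2 := by gcongr
    have h4 : η * μ * μ ≤ 1 * μ := by nlinarith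
    exact le_of_mul_le_mul_right h4 hμ
  have hpow : (1 - η * μ) ^ N ≤ 1 / 8 :=
    (pow_le_pow_left₀ (by linarith) (by linarith) N).trans hN
  refine (expect_innerLoop_norm_sq_fullGrad_le hg hμ hη hLη hημ1 (by simp) (by simp) N).trans ?_
  gcongr
  linarith

theorem BBInvariant.expect_outerLoop_le {L μ : ℝ} {g : Fin n → Vec d → ℝ}
    {st : OuterState d} (hst : BBInvariant L μ (8 * (L / μ) ^ 2) g st)
    (hg : StronglyMonotoneSum L μ g) (hμ : 0 < μ) (hμL : μ ≤ L) {N : ℕ}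
    (hN : (1 - 1 / (8 * (L / μ) ^ 3)) ^ N ≤ 1 / 8) (K : ℕ) :
    expect (RegSarah.outerLoop g (8 * (L / μ) ^ 2) (N + 1) (PMF.pure (Fin.last (N + 1))) K st)
        (fun st' => ‖fullGrad g st'.pt‖ ^ 2)
      ≤ (1 / 2) ^ K * ‖fullGrad g st.pt‖ ^ 2 := by
  have hL : 0 < L := hμ.trans_le hμL
  induction K with
  | zero => simp [RegSarah.outerLoop, expect_pure]
  | succ K ih =>
    have h : expect (RegSarah.outerLoop g (8 * (L / μ) ^ 2) (N + 1)
          (PMF.pure (Fin.last (N + 1))) (K + 1) st) (fun st' => ‖fullGrad g st'.pt‖ ^ 2)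
        ≤ 1 / 2 * expect (RegSarah.outerLoop g (8 * (L / μ) ^ 2) (N + 1)
          (PMF.pure (Fin.last (N + 1))) K st) (fun st' => ‖fullGrad g st'.pt‖ ^ 2) :=
      expect_bind_le (finite_support_outerLoop _ _ _ _ _ _)
        (finite_support_outerStep _ _ _ _) fun s hs =>
          (hst.outerLoop hg hμ (by positivity) s hs).expect_outerStep_le hg hμ hμL hN
    have e : (1 / 2 : ℝ) ^ (K + 1) = 1 / 2 * (1 / 2) ^ K := by ring
    rw [e]
    linarith

/-- Linear convergence of BB-SARAH for a strongly monotone mean gradient. -/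
theorem expect_bbSarah_le {L μ : ℝ} {g : Fin n → Vec d → ℝ} (hg : StronglyMonotoneSum L μ g)
    (hμ : 0 < μ) (hμL : μ ≤ L) {N : ℕ} (hN : (1 - 1 / (8 * (L / μ) ^ 3)) ^ N ≤ 1 / 8)
    (x₀ : Vec d) (K : ℕ) :
    expect (bbSarah g x₀ (1 / (8 * (L / μ) ^ 2 * L)) (8 * (L / μ) ^ 2) (N + 1) K
        (PMF.pure (Fin.last (N + 1)))) (fun out => ‖fullGrad g out.1‖ ^ 2)
      ≤ (1 / 2) ^ K * ‖fullGrad g x₀‖ ^ 2 := by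
  have hL : 0 < L := hμ.trans_le hμL
  rw [bbSarah, expect_map (finite_support_outerLoop _ _ _ _ _ _)]
  refine BBInvariant.expect_outerLoop_le ⟨fun h => absurd rfl h, le_rfl, ?_⟩ hg hμ hμL hN K
  simp only
  gcongr

end OuterLoop

/-! ### The regularized scheme: telescoping and parameter choice -/

section Scheme

variable {n d : ℕ} [NeZero n]

theorem finite_support_regStep (f : Fin n → Vec d → ℝ) (σ θ lam : ℝ) (P : Params) (s : ℕ)
    (tr : Trajectory d) : (regStep f σ θ lam P s tr).support.Finite :=
  finite_support_map _ (finite_support_bbSarah _ _ _ _ _ _ _)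

theorem finite_support_regRun (f : Fin n → Vec d → ℝ) (σ θ lam : ℝ) (P : Params) (x₀ : Vec d)
    (S : ℕ) : (regRun f σ θ lam P x₀ S).support.Finite := by
  induction S with
  | zero => exact finite_support_pure _
  | succ S ih => exact finite_support_bind ih fun tr => finite_support_regStep _ _ _ _ _ _ tr

theorem expect_regStep (f : Fin n → Vec d → ℝ) (σ θ lam : ℝ) (P : Params) (s : ℕ)
    (tr : Trajectory d) (h : Trajectory d → ℝ) :
    expect (regStep f σ θ lam P s tr) h
      = expect (bbSarah (surrogate σ θ (tr.pt (s - 1)) f) (tr.pt (s - 1)) (P.η s) lam (P.m s)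
          (P.K s) (P.p s))
        (fun out => h { pt := Function.update tr.pt s out.1, calls := tr.calls + out.2 }) := by
  rw [regStep, expect_map (finite_support_bbSarah _ _ _ _ _ _ _)]

theorem regRun_support_zero {f : Fin n → Vec d → ℝ} {σ θ lam : ℝ} {P : Params} {x₀ : Vec d}
    {S : ℕ} : ∀ tr ∈ (regRun f σ θ lam P x₀ S).support, tr.pt 0 = x₀ := by
  induction S with
  | zero =>
    intro tr h
    rw [regRun, PMF.support_pure, Set.mem_singleton_iff] at h
    rw [h]
  | succ S ih =>
    intro tr h
    rw [regRun, PMF.mem_support_bind_iff] at h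
    obtain ⟨s, hs, h⟩ := h
    rw [regStep, PMF.support_map] at h
    obtain ⟨out, -, rfl⟩ := h
    simpa using ih s hs

theorem regRun_support_calls {f : Fin n → Vec d → ℝ} {σ θ lam : ℝ} {P : Params} {x₀ : Vec d}
    {N K : ℕ} (hm : ∀ s, P.m s = N + 1) (hK : ∀ s, P.K s = K) {S : ℕ} :
    ∀ tr ∈ (regRun f σ θ lam P x₀ S).support, tr.calls = S * (K * (n + 2 * N)) := by
  induction S with
  | zero =>
    intro tr h
    rw [regRun, PMF.support_pure, Set.mem_singleton_iff] at h
    simp [h]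
  | succ S ih =>
    intro tr h
    rw [regRun, PMF.mem_support_bind_iff] at h
    obtain ⟨s, hs, h⟩ := h
    rw [regStep, PMF.support_map] at h
    obtain ⟨out, hout, rfl⟩ := h
    simp only [ih s hs, bbSarah_support_calls out hout, hm, hK, Nat.add_sub_cancel]
    ring

/-- Later calls do not change the law of the earlier points. -/
theorem expect_regRun_of_le (f : Fin n → Vec d → ℝ) (σ θ lam : ℝ) (P : Params) (x₀ : Vec d)
    {s S : ℕ} (hsS : s ≤ S) (h : Vec d → Vec d → ℝ) :
    expect (regRun f σ θ lam P x₀ S) (fun tr => h (tr.pt (s - 1)) (tr.pt s))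
      = expect (regRun f σ θ lam P x₀ s) (fun tr => h (tr.pt (s - 1)) (tr.pt s)) := by
  induction S, hsS using Nat.le_induction with
  | base => rfl
  | succ S hsS ih =>
    rw [← ih, regRun, expect_bind (finite_support_regRun _ _ _ _ _ _ _)
      (finite_support_regStep _ _ _ _ _ _)]
    refine expect_congr fun tr _ => ?_
    rw [expect_regStep]
    simp only [Function.update_of_ne (show s ≠ S + 1 by omega),
      Function.update_of_ne (show s - 1 ≠ S + 1 by omega)]
    exact expect_const (finite_support_bbSarah _ _ _ _ _ _ _) _

theorem expect_regOutput (f : Fin n → Vec d → ℝ) (σ θ lam : ℝ) (P : Params) (x₀ : Vec d)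
    {S : ℕ} (hS : 1 ≤ S) (h : Vec d → ℝ) :
    expect (regOutput f σ θ lam P x₀ S hS) (fun out => h out.1)
      = 1 / (S : ℝ) *
        ∑ k ∈ Finset.Icc 1 S, expect (regRun f σ θ lam P x₀ S) (fun tr => h (tr.pt k)) := by
  have hfin := finite_support_regRun f σ θ lam P x₀ S
  have hU : (PMF.uniformOfFinset (Finset.Icc 1 S)
      (Finset.nonempty_Icc.mpr hS)).support.Finite := by
    rw [PMF.support_uniformOfFinset]
    exact Finset.finite_toSet _
  rw [regOutput, expect_bind hfin fun _ => finite_support_map _ hU]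
  simp only [expect_map hU, expect_uniformOfFinset, Nat.card_Icc, Nat.add_sub_cancel]
  rw [expect_const_mul, expect_sum hfin]

/-- If every inner solve contracts by `ρ`, then the expected squared gradient norm of the output
is at most a constant divided by `(1 - ρ) S`. -/
theorem expect_regOutput_le {L σ θ Δ : ℝ} (hL : 0 < L) (hθ : 0 < θ) {f : Fin n → Vec d → ℝ}
    {x₀ : Vec d} (hf : ∀ i, HasLipschitzGradient L (f i))
    (hσ : BoundedNonconvex σ (finiteSum f)) (hbdd : BddBelow (Set.range (finiteSum f)))
    (hΔ : finiteSum f x₀ - (⨅ x, finiteSum f x) ≤ Δ) {lam ρ : ℝ} (hρ0 : 0 < ρ) (hρ : ρ < 1)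
    {P : Params} {r : ℕ → ℝ} {S : ℕ} (hS : 1 ≤ S) (hr : ∀ s, 1 ≤ s → r s ≤ ρ)
    (hc : ∀ s, 1 ≤ s → s ≤ S → Contracts f σ θ (regRun f σ θ lam P x₀ S) s (r s)) :
    expect (regOutput f σ θ lam P x₀ S hS) (fun out => ‖gradient (finiteSum f) out.1‖ ^ 2)
      ≤ (2 * (σ + θ) * Δ + 2 * (2 * L + σ) * Δ) / ((1 - ρ) * S) := by
  have hσ0 := hσ.1
  have hd : ∀ i, Differentiable ℝ (f i) := fun i => (hf i).1
  rw [expect_regOutput f σ θ lam P x₀ hS fun x => ‖gradient (finiteSum f) x‖ ^ 2]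
  set q := regRun f σ θ lam P x₀ S with hq
  have hfin : q.support.Finite := finite_support_regRun f σ θ lam P x₀ S
  set w : ℕ → ℝ := fun k => expect q fun tr => ‖gradient (finiteSum f) (tr.pt k)‖ ^ 2 with hw
  set φ : ℕ → ℝ := fun k => expect q fun tr => finiteSum f (tr.pt k) with hφ
  have hw0 : ∀ k, 0 ≤ w k := fun k => expect_nonneg fun tr => by positivity
  have hstep : ∀ k, k < S →
      (1 - ρ) * w k ≤ (2 * (σ + θ) * φ k + w k) - (2 * (σ + θ) * φ (k + 1) + w (k + 1)) := by
    intro k hk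
    have h1 := hc (k + 1) (by omega) (by omega)
    rw [Contracts, Nat.add_sub_cancel] at h1
    set u := expect q fun tr =>
      ‖gradient (finiteSum (surrogate σ θ (tr.pt k) f)) (tr.pt (k + 1))‖ ^ 2 with hu
    have h2 : expect q (fun tr =>
        ‖gradient (finiteSum (surrogate σ θ (tr.pt k) f)) (tr.pt k)‖ ^ 2) = w k := by
      simp only [gradient_finiteSum_surrogate _ hd, sub_self, smul_zero, add_zero, hw]
    rw [h2] at h1
    have h3 : r (k + 1) * w k ≤ ρ * w k :=
      mul_le_mul_of_nonneg_right (hr (k + 1) (by omega)) (hw0 k)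
    have h4 : w k + (2 * (σ + θ) * φ (k + 1) + w (k + 1))
        ≤ u + (2 * (σ + θ) * φ k + w k) := by
      simp only [hw, hφ, hu, ← expect_const_mul, ← expect_add hfin]
      refine expect_mono hfin fun tr _ => ?_
      have := potential_decrease hθ hd hσ (tr.pt k) (tr.pt (k + 1))
      linarith
    linarith
  have hsum : (1 - ρ) * ∑ k ∈ Finset.range S, w k
      ≤ (2 * (σ + θ) * φ 0 + w 0) - (2 * (σ + θ) * φ S + w S) := by
    rw [← Finset.sum_range_sub' (fun k => 2 * (σ + θ) * φ k + w k), Finset.mul_sum]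
    exact Finset.sum_le_sum fun k hk => hstep k (Finset.mem_range.mp hk)
  -- The output averages over `1, …, S`, while the telescoped sum covers `0, …, S - 1`.
  have hshift : ∑ k ∈ Finset.Icc 1 S, w k = ∑ k ∈ Finset.range S, w k + w S - w 0 := by
    rw [← Finset.sum_range_succ, Finset.sum_range_succ', Finset.range_eq_Ico,
      Finset.sum_Ico_add' w 0 S 1, add_sub_cancel_right]
    rfl
  have hzero : ∀ h : Vec d → ℝ, expect q (fun tr => h (tr.pt 0)) = h x₀ := fun h => by
    rw [← expect_const hfin (h x₀)]
    exact expect_congr fun tr htr => by rw [regRun_support_zero tr htr]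
  have hinf : (⨅ x, finiteSum f x) ≤ φ S := by
    rw [← expect_const hfin (⨅ x, finiteSum f x)]
    exact expect_mono hfin fun tr _ => ciInf_le hbdd _
  have hφ0 : φ 0 = finiteSum f x₀ := hzero _
  have hw0' : w 0 ≤ 2 * (2 * L + σ) * Δ :=
    (hzero fun x => ‖gradient (finiteSum f) x‖ ^ 2).trans_le
      (norm_sq_gradient_le hL hf hσ hbdd hΔ)
  have hgap : 2 * (σ + θ) * (φ 0 - φ S) ≤ 2 * (σ + θ) * Δ := by
    gcongr
    linarith
  have hS0 : (0 : ℝ) < S := by exact_mod_cast hS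
  have hρ1 : 0 < 1 - ρ := by linarith
  have hmain : (1 - ρ) * ∑ k ∈ Finset.Icc 1 S, w k
      ≤ 2 * (σ + θ) * Δ + 2 * (2 * L + σ) * Δ := by
    rw [hshift]
    have h1 := mul_nonneg hρ0.le (hw0 S)
    have h2 := mul_nonneg hρ1.le (hw0 0)
    linarith
  rw [le_div_iff₀ (by positivity)]
  calc _ = (1 - ρ) * ∑ k ∈ Finset.Icc 1 S, w k := by field_simp
    _ ≤ _ := hmain

/-- The parameters with constant inner loop length `N + 1`, selection of the last inner iterate,
`K` outer loops and initial step size `η`. -/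
noncomputable def constParams (η : ℝ) (N K : ℕ) : Params where
  η _ := η
  m _ := N + 1
  K _ := K
  p _ := PMF.pure (Fin.last (N + 1))

/-- Given the trajectory before call `s`, the surrogate is fixed and its centre is the starting
point, so `expect_bbSarah_le` applies conditionally. Averaging over the trajectory preserves the
factor. -/
theorem contracts_constParams {L σ θ : ℝ} (hL : 0 < L) (hθ : 0 < θ)
    {f : Fin n → Vec d → ℝ} (hf : ∀ i, HasLipschitzGradient L (f i))
    (hσ : BoundedNonconvex σ (finiteSum f)) (x₀ : Vec d) {N : ℕ}
    (hN : (1 - 1 / (8 * ((L + σ + θ) / θ) ^ 3)) ^ N ≤ 1 / 8) (K : ℕ) {S s : ℕ} (hs : 1 ≤ s)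
    (hsS : s ≤ S) :
    Contracts f σ θ (regRun f σ θ (8 * ((L + σ + θ) / θ) ^ 2)
      (constParams (1 / (8 * ((L + σ + θ) / θ) ^ 2 * (L + σ + θ))) N K) x₀ S) s
      ((1 / 2) ^ K) := by
  have hσ0 := hσ.1
  have hd : ∀ i, Differentiable ℝ (f i) := fun i => (hf i).1
  obtain ⟨t, rfl⟩ : ∃ t, s = t + 1 := ⟨s - 1, by omega⟩
  unfold Contracts
  set P := constParams (1 / (8 * ((L + σ + θ) / θ) ^ 2 * (L + σ + θ))) N K with hP
  -- The contraction is stated under the law of all `S` calls; both sides are first moved to the law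
  -- right after call `s`.
  rw [expect_regRun_of_le f σ θ _ P x₀ hsS
      fun c x => ‖gradient (finiteSum (surrogate σ θ c f)) x‖ ^ 2,
    expect_regRun_of_le f σ θ _ P x₀ hsS
      fun c _ => ‖gradient (finiteSum (surrogate σ θ c f)) c‖ ^ 2]
  simp only [Nat.add_sub_cancel]
  have hmarg : expect (regRun f σ θ (8 * ((L + σ + θ) / θ) ^ 2) P x₀ (t + 1))
        (fun tr => ‖gradient (finiteSum (surrogate σ θ (tr.pt t) f)) (tr.pt t)‖ ^ 2)
      = expect (regRun f σ θ (8 * ((L + σ + θ) / θ) ^ 2) P x₀ t)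
        (fun tr => ‖gradient (finiteSum (surrogate σ θ (tr.pt t) f)) (tr.pt t)‖ ^ 2) :=
    expect_regRun_of_le f σ θ _ P x₀ (Nat.le_succ t)
      fun _ x => ‖gradient (finiteSum (surrogate σ θ x f)) x‖ ^ 2
  rw [hmarg, regRun]
  refine expect_bind_le (finite_support_regRun _ _ _ _ _ _ _)
    (finite_support_regStep _ _ _ _ _ _) fun tr _ => ?_
  rw [expect_regStep]
  simp only [Nat.add_sub_cancel, Function.update_self,
    Function.update_of_ne (show t ≠ t + 1 by omega),
    gradient_finiteSum fun i => differentiable_surrogate _ (hd i)]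
  exact expect_bbSarah_le (stronglyMonotoneSum_surrogate hθ hf hσ (tr.pt t)) hθ (by linarith)
    hN (tr.pt t) K

theorem regOutput_support_calls {f : Fin n → Vec d → ℝ} {σ θ lam : ℝ} {P : Params}
    {x₀ : Vec d} {N K : ℕ} (hm : ∀ s, P.m s = N + 1) (hK : ∀ s, P.K s = K) {S : ℕ}
    {hS : 1 ≤ S} :
    ∀ out ∈ (regOutput f σ θ lam P x₀ S hS).support, out.2 = S * (K * (n + 2 * N)) := by
  intro out h
  rw [regOutput, PMF.mem_support_bind_iff] at h
  obtain ⟨tr, htr, h⟩ := h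
  rw [PMF.support_map] at h
  obtain ⟨k, -, rfl⟩ := h
  exact regRun_support_calls hm hK tr htr

theorem exists_inner_length {κ : ℝ} (hκ : 1 ≤ κ) :
    ∃ N : ℕ, (1 - 1 / (8 * κ ^ 3)) ^ N ≤ 1 / 8 := by
  have h1 : 1 ≤ κ ^ 3 := one_le_pow₀ hκ
  have h2 : 0 < 1 / (8 * κ ^ 3) := by positivity
  obtain ⟨N, hN⟩ := exists_pow_lt_of_lt_one (by norm_num : (0 : ℝ) < 1 / 8)
    (by linarith : 1 - 1 / (8 * κ ^ 3) < 1)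
  exact ⟨N, hN.le⟩

/-- A number of halvings that reaches `ρ ^ B`, bounded in terms of the target complexity. -/
theorem exists_outer_length {ρ B : ℝ} (hρ0 : 0 < ρ) (hρ : ρ < 1) (hB : 1 ≤ B) :
    ∃ K : ℕ, 1 ≤ K ∧ (1 / 2 : ℝ) ^ K ≤ ρ ^ B ∧
      (K : ℝ) ≤ (2 * B + 2) * (Real.log (1 / ρ) / (1 - ρ)) := by
  set ℓ := Real.log (1 / ρ) with hℓ
  have hℓ' : ℓ = -Real.log ρ := by rw [hℓ, one_div, Real.log_inv]
  have hℓ1 : 1 - ρ ≤ ℓ := by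
    have := Real.log_le_sub_one_of_pos hρ0
    linarith
  have hρ1 : 0 < 1 - ρ := by linarith
  have hℓ0 : 0 < ℓ := by linarith
  have hlog2 : 1 / 2 < Real.log 2 := by linarith [Real.log_two_gt_d9]
  have h1 : 1 ≤ ℓ / (1 - ρ) := by rwa [le_div_iff₀ hρ1, one_mul]
  have h2 : ℓ ≤ ℓ / (1 - ρ) := by
    rw [le_div_iff₀ hρ1]
    nlinarith
  have hK := Nat.le_ceil (2 * B * ℓ)
  have hK' := Nat.ceil_lt_add_one (by positivity : 0 ≤ 2 * B * ℓ)
  -- Since `log 2 > 1/2`, `2Bℓ` halvings already reach `ρ ^ B`. The extra `1` ensures `K ≥ 1`, and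
  -- `ℓ / (1 - ρ) ≥ 1` pays for it and for the ceiling.
  refine ⟨⌈2 * B * ℓ⌉₊ + 1, by omega, ?_, ?_⟩
  · rw [← Real.log_le_log_iff (by positivity) (by positivity), Real.log_pow,
      Real.log_rpow hρ0, one_div, Real.log_inv]
    push_cast
    have h3 : (2 * B * ℓ) * (1 / 2) ≤ ((⌈2 * B * ℓ⌉₊ : ℝ) + 1) * Real.log 2 :=
      mul_le_mul (by linarith) hlog2.le (by norm_num) (by positivity)
    nlinarith
  · push_cast
    have h3 : 2 * B * ℓ ≤ 2 * B * (ℓ / (1 - ρ)) := by gcongr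
    linarith

end Scheme

end RegSarah

/-! ### Constants and the complexity bound -/

open RegSarah in
theorem corollary4 :
    ∃ c : ℝ, 0 < c ∧
    ∀ L σ θ Δ B : ℝ, 0 < L → 0 < σ → 0 < θ → 0 ≤ Δ → 1 ≤ B →
    ∃ C : ℝ, 0 < C ∧
    ∀ (n d : ℕ) [NeZero n] (f : Fin n → Vec d → ℝ) (x₀ : Vec d),
      (∀ i, HasLipschitzGradient L (f i)) →
      BoundedNonconvex σ (finiteSum f) →
      BddBelow (Set.range (finiteSum f)) →
      finiteSum f x₀ - (⨅ x, finiteSum f x) ≤ Δ →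
    ∀ (ρ : ℝ) (r : ℕ → ℝ), 0 < ρ → ρ < 1 → (∀ s, 1 ≤ s → r s ≤ ρ) →
      -- every choice of the parameters for which the inner solves contract
      (∀ (lam : ℝ) (P : Params) (ε : ℝ) (S : ℕ) (hS : 1 ≤ S), 0 < ε →
        (∀ s, 1 ≤ s → s ≤ S → Contracts f σ θ (regRun f σ θ lam P x₀ S) s (r s)) →
        C / ((1 - ρ) * ε) ≤ (S : ℝ) →
        expect (regOutput f σ θ lam P x₀ S hS)
          (fun out => ‖gradient (finiteSum f) out.1‖ ^ 2) ≤ ε) ∧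
      -- a choice of the parameters with the claimed complexity
      ((∀ s, 1 ≤ s → ρ ^ B ≤ r s) →
        ∀ ε : ℝ, 0 < ε → ε ≤ 1 →
        ∃ (P : Params) (S : ℕ) (hS : 1 ≤ S),
          (∀ s, 1 ≤ s → s ≤ S → 0 < P.η s ∧ 1 ≤ P.m s ∧ 1 ≤ P.K s) ∧
          (∀ s, 1 ≤ s → s ≤ S →
            Contracts f σ θ (regRun f σ θ (c * ((L + σ + θ) / θ) ^ 2) P x₀ S) s (r s)) ∧
          expect (regOutput f σ θ (c * ((L + σ + θ) / θ) ^ 2) P x₀ S hS)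
            (fun out => ‖gradient (finiteSum f) out.1‖ ^ 2) ≤ ε ∧
          ∀ out ∈ (regOutput f σ θ (c * ((L + σ + θ) / θ) ^ 2) P x₀ S hS).support,
            (out.2 : ℝ) ≤ C * ((n : ℝ) / ((1 - ρ) * ε) * Real.log (1 / ρ))) := by
  refine ⟨8, by norm_num, fun L σ θ Δ B hL hσ0 hθ hΔ0 hB => ?_⟩
  obtain ⟨N, hN⟩ := exists_inner_length (κ := (L + σ + θ) / θ)
    (by rw [le_div_iff₀ hθ]; linarith)
  set A := 2 * (σ + θ) * Δ + 2 * (2 * L + σ) * Δ with hA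
  have hA0 : 0 ≤ A := by positivity
  -- The summand `A` serves the first statement. The other is the product of the constants in the
  -- bounds for `S`, for `K` and for the cost `n + 2N ≤ n (1 + 2N)` of an outer loop; `N` depends
  -- only on `κ`.
  refine ⟨A + (2 * A + 2) * ((2 * B + 2) * (1 + 2 * N)), by positivity, ?_⟩
  intro n d _ f x₀ hf hσ hbdd hΔ ρ r hρ0 hρ hr
  have hρ1 : 0 < 1 - ρ := by linarith
  refine ⟨fun lam P ε S hS hε hc hSC => ?_, fun hrB ε hε hε1 => ?_⟩
  · have hS0 : (0 : ℝ) < S := by exact_mod_cast hS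
    refine (expect_regOutput_le hL hθ hf hσ hbdd hΔ hρ0 hρ hS hr hc).trans ?_
    rw [div_le_iff₀ (by positivity)] at hSC ⊢
    have : 0 ≤ (2 * A + 2) * ((2 * B + 2) * (1 + 2 * (N : ℝ))) := by positivity
    linarith
  · obtain ⟨K, hK1, hKρ, hKle⟩ := exists_outer_length hρ0 hρ hB
    have hhalf : (1 / 2 : ℝ) ^ K ≤ 1 / 2 :=
      (pow_le_pow_of_le_one (by norm_num) (by norm_num) hK1).trans_eq (pow_one _)
    have hcon := fun S s (hs : 1 ≤ s) (hsS : s ≤ S) =>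
      contracts_constParams hL hθ hf hσ x₀ hN K hs hsS
    have hceil := Nat.le_ceil (2 * A / ε)
    have hceil' := Nat.ceil_lt_add_one (by positivity : 0 ≤ 2 * A / ε)
    -- With contraction factor `1/2` the bound on the output is `2A/S`. The extra `1` covers `A =
    -- 0`, and `ε ≤ 1` absorbs the rounding into `(2A + 2)/ε`.
    set S := ⌈2 * A / ε⌉₊ + 1 with hSdef
    have hS : 1 ≤ S := by omega
    have hSge : 2 * A / ε ≤ S := by rw [hSdef]; push_cast; linarith
    have hSle : (S : ℝ) ≤ (2 * A + 2) / ε := by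
      have : 2 ≤ 2 / ε := by rw [le_div_iff₀ hε]; linarith
      rw [hSdef, add_div]; push_cast; linarith
    refine ⟨constParams (1 / (8 * ((L + σ + θ) / θ) ^ 2 * (L + σ + θ))) N K, S, hS,
      fun s _ _ => ⟨?_, ?_, hK1⟩, fun s hs hsS => ?_, ?_, fun out hout => ?_⟩
    · simp only [constParams]
      positivity
    · simp only [constParams]
      omega
    · refine (hcon S s hs hsS).trans ?_
      exact mul_le_mul_of_nonneg_right (hKρ.trans (hrB s hs))
        (expect_nonneg fun tr => by positivity)
    · have hS0 : (0 : ℝ) < S := by exact_mod_cast hS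
      -- The actual factor `(1/2)^K ≤ 1/2` replaces `ρ`, which keeps `1/(1-ρ)` out of `S`.
      refine (expect_regOutput_le hL hθ hf hσ hbdd hΔ (by norm_num : (0 : ℝ) < 1 / 2)
        (by norm_num) hS (r := fun _ => (1 / 2) ^ K) (fun _ _ => hhalf) (hcon S)).trans ?_
      rw [div_le_iff₀ (by positivity)]
      rw [div_le_iff₀ hε] at hSge
      linarith
    · rw [regOutput_support_calls (fun _ => rfl) (fun _ => rfl) out hout]
      have hn : (1 : ℝ) ≤ n := by exact_mod_cast NeZero.one_le
      have hℓ : 0 ≤ Real.log (1 / ρ) :=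
        Real.log_nonneg (by rw [le_div_iff₀ hρ0]; linarith)
      have hnN : (n : ℝ) + 2 * N ≤ n * (1 + 2 * N) := by
        nlinarith [Nat.cast_nonneg (α := ℝ) N]
      push_cast
      calc (S : ℝ) * (K * (n + 2 * N))
          ≤ (2 * A + 2) / ε *
            ((2 * B + 2) * (Real.log (1 / ρ) / (1 - ρ)) * (n * (1 + 2 * N))) := by gcongr
        _ = (2 * A + 2) * ((2 * B + 2) * (1 + 2 * N)) *
            (n / ((1 - ρ) * ε) * Real.log (1 / ρ)) := by field_simp
        _ ≤ _ := by
            gcongr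
            linarith
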